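/- Let $f(x)=x^5+a_4x^4+a_3x^3+a_2x^2+a_1x+a_0$ be a polynomial with real coefficients. Set $$u_2=\tfrac{3}{10}a_3-\tfrac{3}{25}a_4^2,\qquad u_3=\tfrac{2}{125}a_4^3-\tfrac{3}{50}a_3a_4+\tfrac1{10}a_2,\qquad u_4=-\tfrac{3}{625}a_4^4+\tfrac{3}{125}a_4^2a_3-\tfrac{2}{25}a_4a_2+\tfrac15a_1 .$$ **The values $\theta_j$.** Let $\Delta=u_3^2+\frac{4}{27}u_2^3$, let $\sqrt\Delta$ be a complex square root of $\Delta$, $\zeta$ a primitive third root of unity, and $\omega\in\mathbb C$ a third root of $\frac12(-u_3+\sqrt\Delta)$. Let $S$ be the family, with repetitions, of the three complex numbers $$-\zeta^{k}\omega\Big(\tfrac{9u_3}{2}+\tfrac{3\sqrt\Delta}{2}\Big)-\zeta^{-k}\overline{\omega}\Big(\tfrac{9u_3}{2}-\tfrac{3\sqrt\Delta}{2}\Big)+\tfrac{2u_2^2}{3},\qquad k=0,1,2.$$ When they are real, denote them by $\theta_1\le\theta_2\le\theta_3$. **The values $\lambda_j$.** Define complex numbers $x_{i_1,i_2}$ for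 $i_1,i_2\in\{+1,-1\}$ as follows. If $u_3=0$, put $x_{i_1,i_2}=i_1\sqrt{-u_2+i_2\sqrt{u_2^2-u_4}}$. If $u_3\ne0$, put $$x_{i_1,i_2}=\tfrac12\Big(i_1\sqrt{2y}+i_2\sqrt{-4u_2-2y-i_1\tfrac{8u_3}{\sqrt{2y}}}\Big),\qquad y=C-\frac{v_2}{3C}-\frac{2u_2}{3},$$ where $v_2=-\frac{u_2^2}{3}-u_4$, $v_3=\frac{2u_2u_4}{3}-\frac{2u_2^3}{27}-2u_3^2$, and $C\in\mathbb C$ is a third root of $-v_3$ if $v_2=0$ and of $\frac12\big(-v_3+\sqrt{v_3^2+\frac4{27}v_2^3}\big)$ if $v_2\neq0$; the term $\frac{v_2}{3C}$ is read as $0$ when $v_2=0$. The complex square and third roots may be chosen arbitrarily, each root being fixed once and used at all its occurrences. When the four numbers $x_{i_1,i_2}-\frac{a_4}{5}$ are real, denote them, with repetitions, by $\beta_4\le\beta_3\le\beta_2\le\beta_1$, put $g(\beta)=\beta^5+a_4\beta^4+a_3\beta^3+a_2\beta^2+a_1\beta$, and define $$\lambda_1=\max\{g(\beta_1),g(\beta_3)\},\qquad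 \lambda_2=\min\{g(\beta_2),g(\beta_4)\}.$$ Consider the conditions - (i) $a_4\le0$; - (ii) $0\le a_3$; - (iii) $a_3\le\frac25a_4^2$; - (iv) $\frac35a_3a_4-\frac4{25}a_4^3-\frac52\big(\frac4{25}a_4^2-\frac25a_3\big)^{3/2}\le a_2\le\frac35a_3a_4-\frac4{25}a_4^3+\frac52\big(\frac4{25}a_4^2-\frac25a_3\big)^{3/2}$; - (v) $a_2\le0$; - (vi) the elements of $S$ are real and $\frac{3}{125}a_4^4-\frac{3}{25}a_4^2a_3+\frac25a_2a_4+5\theta_1\le a_1\le\frac{3}{125}a_4^4-\frac{3}{25}a_4^2a_3+\frac25a_2a_4+5\theta_2$; - (vii) $0\le a_1$; - (viii) $a_0\le0$; - (ix) the numbers $x_{i_1,i_2}-\frac{a_4}5$ are real and $-\lambda_2\le a_0\le-\lambda_1$. Then, for every choice of the roots above: 1. If all complex roots of $f$ are real, or (i)–(v) hold, then the elements of $S$ are real. 2. If all complex roots of $f$ are real, or (i)–(vii) hold, then the four numbers $x_{i_1,i_2}-\frac{a_4}{5}$ are real. 3. All complex roots of $f$ are real and non-negative if and only if (i)–(ix)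 hold. 4. All complex roots of $f$ are real and positive if and only if (i)–(ix) hold and the inequalities in (i), (ii), (v), (vii) and (viii) are strict. -/

import Mathlib

open Polynomial

namespace MonicQuintic

/-- The monic real quintic `x ^ 5 + a₄ x ^ 4 + a₃ x ^ 3 + a₂ x ^ 2 + a₁ x + a₀`. -/
noncomputable def quintic (a₀ a₁ a₂ a₃ a₄ : ℝ) : ℝ[X] :=
  X ^ 5 + C a₄ * X ^ 4 + C a₃ * X ^ 3 + C a₂ * X ^ 2 + C a₁ * X + C a₀

/-- All complex roots of `f` are real. -/
def AllRootsReal (f : ℝ[X]) : Prop :=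
  ∀ z : ℂ, aeval z f = 0 → ∃ r : ℝ, z = r

/-- All complex roots of `f` are real and non-negative. -/
def AllRootsNonneg (f : ℝ[X]) : Prop :=
  ∀ z : ℂ, aeval z f = 0 → ∃ r : ℝ, 0 ≤ r ∧ z = r

/-- All complex roots of `f` are real and positive. -/
def AllRootsPos (f : ℝ[X]) : Prop :=
  ∀ z : ℂ, aeval z f = 0 → ∃ r : ℝ, 0 < r ∧ z = r

/-- The coefficients `u₂, u₃, u₄` of the depressed quartic
`f' (x - a₄ / 5) / 5 = x ^ 4 + 2 u₂ x ^ 2 + 4 u₃ x + u₄`. -/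
noncomputable def u₂ (a₃ a₄ : ℝ) : ℝ := 3 / 10 * a₃ - 3 / 25 * a₄ ^ 2

/-- See `u₂`. -/
noncomputable def u₃ (a₂ a₃ a₄ : ℝ) : ℝ :=
  2 / 125 * a₄ ^ 3 - 3 / 50 * a₃ * a₄ + 1 / 10 * a₂

/-- See `u₂`. -/
noncomputable def u₄ (a₁ a₂ a₃ a₄ : ℝ) : ℝ :=
  -(3 / 625) * a₄ ^ 4 + 3 / 125 * a₄ ^ 2 * a₃ - 2 / 25 * a₄ * a₂ + 1 / 5 * a₁

/-- `S : Fin 3 → ℂ` lists, with repetitions, the three Cardano values attached to `u₂, u₃`, for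
some choice of a square root `δ` of `Δ = u₃ ^ 2 + 4 / 27 * u₂ ^ 3`, of a primitive third root of
unity `ζ`, and of a third root `ω` of `(-u₃ + δ) / 2`. -/
def IsCardanoFamily (u₂ u₃ : ℝ) (S : Fin 3 → ℂ) : Prop :=
  ∃ δ ζ ω : ℂ,
    δ ^ 2 = (u₃ : ℂ) ^ 2 + 4 / 27 * (u₂ : ℂ) ^ 3 ∧
    IsPrimitiveRoot ζ 3 ∧
    ω ^ 3 = 1 / 2 * (-(u₃ : ℂ) + δ) ∧
    ∀ k : Fin 3, S k =
      -(ζ ^ (k : ℕ) * ω * (9 * (u₃ : ℂ) / 2 + 3 * δ / 2))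
        - ζ⁻¹ ^ (k : ℕ) * (starRingEnd ℂ) ω * (9 * (u₃ : ℂ) / 2 - 3 * δ / 2)
        + 2 * (u₂ : ℂ) ^ 2 / 3

/-- The coefficients `v₂, v₃` of the depressed resolvent cubic. -/
noncomputable def v₂ (u₂ u₄ : ℝ) : ℝ := -(u₂ ^ 2 / 3) - u₄

/-- See `v₂`. -/
noncomputable def v₃ (u₂ u₃ u₄ : ℝ) : ℝ :=
  2 * u₂ * u₄ / 3 - 2 * u₂ ^ 3 / 27 - 2 * u₃ ^ 2

/-- `x i₁ i₂`, for signs `i₁, i₂ ∈ {1, -1}`, are Ferrari's four expressions for the roots of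
`x ^ 4 + 2 u₂ x ^ 2 + 4 u₃ x + u₄`, for some choice of all the complex square and third roots in
them. Here `s` is `√(u₂ ^ 2 - u₄)` and `t i₂` is `√(-u₂ + i₂ s)` when `u₃ = 0`; when `u₃ ≠ 0`,
`d` is `√(v₃ ^ 2 + 4 / 27 * v₂ ^ 3)`, `r` is `√(2 y)` and
`t i₁` is `√(-4 u₂ - 2 y - i₁ * 8 u₃ / √(2 y))`.
If `v₂ = 0` then the term `v₂ / (3 c)` is `0`, even for `c = 0`. -/
def IsFerrariFamily (u₂ u₃ u₄ : ℝ) (x : ℤˣ → ℤˣ → ℂ) : Prop :=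
  (u₃ = 0 → ∃ (s : ℂ) (t : ℤˣ → ℂ),
    s ^ 2 = (u₂ : ℂ) ^ 2 - (u₄ : ℂ) ∧
    (∀ i₂ : ℤˣ, t i₂ ^ 2 = -(u₂ : ℂ) + ((i₂ : ℤ) : ℂ) * s) ∧
    ∀ i₁ i₂ : ℤˣ, x i₁ i₂ = ((i₁ : ℤ) : ℂ) * t i₂) ∧
  (u₃ ≠ 0 → ∃ (d c y r : ℂ) (t : ℤˣ → ℂ),
    d ^ 2 = (v₃ u₂ u₃ u₄ : ℂ) ^ 2 + 4 / 27 * (v₂ u₂ u₄ : ℂ) ^ 3 ∧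
    (v₂ u₂ u₄ = 0 → c ^ 3 = -(v₃ u₂ u₃ u₄ : ℂ)) ∧
    (v₂ u₂ u₄ ≠ 0 → c ^ 3 = 1 / 2 * (-(v₃ u₂ u₃ u₄ : ℂ) + d)) ∧
    y = c - (v₂ u₂ u₄ : ℂ) / (3 * c) - 2 * (u₂ : ℂ) / 3 ∧
    r ^ 2 = 2 * y ∧
    (∀ i₁ : ℤˣ, t i₁ ^ 2 =
      -4 * (u₂ : ℂ) - 2 * y - ((i₁ : ℤ) : ℂ) * (8 * (u₃ : ℂ) / r)) ∧
    ∀ i₁ i₂ : ℤˣ, x i₁ i₂ = (((i₁ : ℤ) : ℂ) * r + ((i₂ : ℤ) : ℂ) * t i₁) / 2)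

/-- The members of the finite family `s` of complex numbers, counted with repetitions, are the
real numbers `t 0 ≤ t 1 ≤ ⋯`. -/
def IsSortedReal {ι : Type} {n : ℕ} (s : ι → ℂ) (t : Fin n → ℝ) : Prop :=
  Monotone t ∧ ∃ σ : Fin n ≃ ι, ∀ i, s (σ i) = (t i : ℂ)

/-- The inequalities on `a₄, a₃, a₂` (they express that `f''` has only real non-negative roots).
The power `3 / 2` has a non-negative base by the third inequality. -/
def CondsOneToFive (a₂ a₃ a₄ : ℝ) : Prop :=
  a₄ ≤ 0 ∧
  0 ≤ a₃ ∧
  a₃ ≤ 2 / 5 * a₄ ^ 2 ∧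
  (3 / 5 * a₃ * a₄ - 4 / 25 * a₄ ^ 3
      - 5 / 2 * (4 / 25 * a₄ ^ 2 - 2 / 5 * a₃) ^ (3 / 2 : ℝ) ≤ a₂ ∧
    a₂ ≤ 3 / 5 * a₃ * a₄ - 4 / 25 * a₄ ^ 3
      + 5 / 2 * (4 / 25 * a₄ ^ 2 - 2 / 5 * a₃) ^ (3 / 2 : ℝ)) ∧
  a₂ ≤ 0

/-- The two-sided bound on `a₁`: the values `S` are real, `θ₁ ≤ θ₂ ≤ θ₃` (here `θ 0 ≤ θ 1 ≤ θ 2`), and the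
bounds on `a₁` hold. -/
def CondSix (a₁ a₂ a₃ a₄ : ℝ) (S : Fin 3 → ℂ) : Prop :=
  ∃ θ : Fin 3 → ℝ, IsSortedReal S θ ∧
    3 / 125 * a₄ ^ 4 - 3 / 25 * a₄ ^ 2 * a₃ + 2 / 5 * a₂ * a₄ + 5 * θ 0 ≤ a₁ ∧
    a₁ ≤ 3 / 125 * a₄ ^ 4 - 3 / 25 * a₄ ^ 2 * a₃ + 2 / 5 * a₂ * a₄ + 5 * θ 1

/-- The translates `x i₁ i₂ - a₄ / 5`, indexed by pairs of signs. -/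
noncomputable def shifted (a₄ : ℝ) (x : ℤˣ → ℤˣ → ℂ) : ℤˣ × ℤˣ → ℂ :=
  fun i => x i.1 i.2 - (a₄ : ℂ) / 5

/-- `f (β) - f (0)` for the quintic `f`. -/
def valueAt (a₁ a₂ a₃ a₄ β : ℝ) : ℝ :=
  β ^ 5 + a₄ * β ^ 4 + a₃ * β ^ 3 + a₂ * β ^ 2 + a₁ * β

/-- `λ₁`, for the sorted roots `β₄ ≤ β₃ ≤ β₂ ≤ β₁` listed as `b 0 ≤ b 1 ≤ b 2 ≤ b 3`. -/
noncomputable def lam₁ (a₁ a₂ a₃ a₄ : ℝ) (b : Fin 4 → ℝ) : ℝ :=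
  max (valueAt a₁ a₂ a₃ a₄ (b 3)) (valueAt a₁ a₂ a₃ a₄ (b 1))

/-- `λ₂`, for the sorted roots `β₄ ≤ β₃ ≤ β₂ ≤ β₁` listed as `b 0 ≤ b 1 ≤ b 2 ≤ b 3`. -/
noncomputable def lam₂ (a₁ a₂ a₃ a₄ : ℝ) (b : Fin 4 → ℝ) : ℝ :=
  min (valueAt a₁ a₂ a₃ a₄ (b 2)) (valueAt a₁ a₂ a₃ a₄ (b 0))

/-- The two-sided bound on `a₀`: the numbers `x i₁ i₂ - a₄ / 5` are real, and `-λ₂ ≤ a₀ ≤ -λ₁`. -/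
def CondNine (a₀ a₁ a₂ a₃ a₄ : ℝ) (x : ℤˣ → ℤˣ → ℂ) : Prop :=
  ∃ b : Fin 4 → ℝ, IsSortedReal (shifted a₄ x) b ∧
    -lam₂ a₁ a₂ a₃ a₄ b ≤ a₀ ∧ a₀ ≤ -lam₁ a₁ a₂ a₃ a₄ b

/-- All the inequalities on the coefficients together. -/
def CondsOneToNine (a₀ a₁ a₂ a₃ a₄ : ℝ) (S : Fin 3 → ℂ) (x : ℤˣ → ℤˣ → ℂ) : Prop :=
  CondsOneToFive a₂ a₃ a₄ ∧ CondSix a₁ a₂ a₃ a₄ S ∧ 0 ≤ a₁ ∧ a₀ ≤ 0 ∧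
    CondNine a₀ a₁ a₂ a₃ a₄ x

end MonicQuintic

namespace MonicQuintic

/-! ### Real-rootedness through critical values -/

section RealRooted

/-! Suppose `f` has positive leading coefficient and only real critical points. Then `f` is
real-rooted exactly when its critical values, taken in order, weakly alternate in sign
(`splits_iff_alternating`). Necessity comes from Laguerre's inequality; sufficiency comes from the
intermediate value theorem, with a multiplicity count that covers coinciding critical points.
Real-rootedness also passes to derivatives, so the criterion can be used along the chain cubic,
quartic, quintic, where up to scaling and the shift by `a₄ / 5` each polynomial is the derivative of
the next.

The cubic `x³ + u₂ x + u₃` is real-rooted iff `Δ ≤ 0`, which is (iii) and (iv)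
(`coefficient_bounds_iff`). In that case the members of `S` are the values of `-(x⁴ + 2 u₂ x² + 4 u₃
x)` at the roots of the cubic. The middle root gives the smallest one, so alternation for the
quartic reads `θ₁ ≤ u₄ ≤ θ₂`, which is (vi). Ferrari's numbers are the roots of the quartic, so
after the shift they are the critical points of the quintic, and alternation there is (ix).

Real roots are then non-negative exactly when the coefficients have the signs in (i), (ii), (v),
(vii), (viii): one direction is Vieta, the other holds because every term of `f` is non-positive at
a negative argument. Positivity only adds that `0` is not a root. -/

theorem splits_derivative {f : ℝ[X]} (hf : f.Splits) : f.derivative.Splits := by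
  rcases Nat.eq_zero_or_pos f.natDegree with h0 | h0
  · rw [eq_C_of_natDegree_eq_zero h0]
    simp
  · rw [splits_iff_card_roots] at hf ⊢
    have h1 := card_roots_le_derivative f
    have h2 := card_roots' f.derivative
    have h3 := natDegree_derivative_lt h0.ne'
    omega

/-- Multiplying `g` by `X - r` turns the Laguerre expression `L` of `g` into `g² + (x - r)² L`, so
non-negativity is inherited. -/
theorem laguerre_nonneg (s : Multiset ℝ) (x : ℝ) :
    0 ≤ ((s.map fun a => X - C a).prod.derivative.eval x) ^ 2
      - (s.map fun a => X - C a).prod.eval x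
        * (s.map fun a => X - C a).prod.derivative.derivative.eval x := by
  induction s using Multiset.induction_on with
  | empty => simp
  | cons r s ih =>
    set g := (s.map fun a => X - C a).prod with hg
    simp only [Multiset.map_cons, Multiset.prod_cons, ← hg]
    simp only [derivative_mul, derivative_sub, derivative_X, derivative_C, sub_zero, one_mul,
      derivative_add, eval_add, eval_mul, eval_sub, eval_X, eval_C]
    nlinarith [mul_nonneg (sq_nonneg (x - r)) ih, sq_nonneg (g.eval x)]

/-- Splitting off one root makes Laguerre's inequality strict. If `f = k (X - r) g` and `f' = 0` at
`c`, then `(c - r) g' = -g` at `c`, and Laguerre for `g` gives `f f'' ≤ -k² g²` there. -/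
theorem laguerre_critical {f : ℝ[X]} (hf : f.Splits) (hdeg : 0 < f.natDegree) {c : ℝ}
    (hc : f.derivative.eval c = 0) :
    f.eval c = 0 ∨ f.eval c * f.derivative.derivative.eval c < 0 := by
  by_contra! hcon
  obtain ⟨h0, h1⟩ := hcon
  have hroots := hf.eq_prod_roots
  have hcard : 0 < Multiset.card f.roots := by
    rw [← hf.natDegree_eq_card_roots]; exact hdeg
  obtain ⟨r, hr⟩ := Multiset.card_pos_iff_exists_mem.1 hcard
  obtain ⟨s, hs⟩ := Multiset.exists_cons_of_mem hr
  rw [hs] at hroots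
  have hL := laguerre_nonneg s c
  set g := (s.map fun a => X - C a).prod with hg
  simp only [Multiset.map_cons, Multiset.prod_cons, ← hg] at hroots
  set k := f.leadingCoeff
  rw [hroots] at h0 h1 hc
  simp only [derivative_mul, derivative_sub, derivative_X, derivative_C, sub_zero, one_mul,
    derivative_add, eval_add, eval_mul, eval_sub, eval_X, eval_C, zero_mul, zero_add] at h0 h1 hc
  have hk : k ≠ 0 := left_ne_zero_of_mul h0
  have hg0 : g.eval c ≠ 0 := right_ne_zero_of_mul (right_ne_zero_of_mul h0)
  have hc' : g.eval c + (c - r) * g.derivative.eval c = 0 :=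
    (mul_eq_zero.1 hc).resolve_left hk
  have hpos : 0 < k ^ 2 * (g.eval c ^ 2) := by positivity
  have e : g.eval c = - ((c - r) * g.derivative.eval c) := by linarith
  have key : 0 ≤ k ^ 2 * ((c - r) ^ 2 * (g.derivative.eval c ^ 2
      - g.eval c * g.derivative.derivative.eval c)) := by positivity
  nlinarith [key, hpos, h1, congrArg (fun t => k ^ 2 * g.eval c * t) hc',
    congrArg (fun t => k ^ 2 * ((c - r) * g.derivative.eval c) * t) hc']

/-- The `r i` may coincide, so they have to be counted with multiplicity. A value taken `m` times by
`r` pinches at least `m - 1` of the `c j`; it is then a root of `f'` of multiplicity at least `m -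
1`, hence of `f` of multiplicity at least `m`. -/
theorem splits_of_interlacing {n : ℕ} {f : ℝ[X]} (hdeg : f.natDegree = n + 1) {k : ℝ}
    {c : Fin n → ℝ} (hf' : f.derivative = C k * ∏ i, (X - C (c i))) {r : Fin (n + 1) → ℝ}
    (hr : ∀ i, f.eval (r i) = 0) (h₁ : ∀ j : Fin n, r j.castSucc ≤ c j)
    (h₂ : ∀ j : Fin n, c j ≤ r j.succ) : f.Splits := by
  have hf0 : f ≠ 0 := by rintro rfl; simp at hdeg
  have hd0 : f.derivative ≠ 0 := by
    intro h
    have := Polynomial.derivative_eq_zero.1 h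
    omega
  have hmono : Monotone r := Fin.monotone_iff_le_succ.2 fun j => (h₁ j).trans (h₂ j)
  have hk : k ≠ 0 := by rintro rfl; exact hd0 (by rw [hf', C_0, zero_mul])
  have hroots : f.derivative.roots = Finset.univ.val.map c := by
    rw [hf', roots_C_mul _ hk]
    exact roots_multiset_prod_X_sub_C (Finset.univ.val.map c) ▸ by
      simp [Finset.prod, Function.comp_def]
  have hle : Finset.univ.val.map r ≤ f.roots := by
    rw [Multiset.le_iff_count]
    intro v
    rw [count_roots]
    by_cases hv : ∃ i, r i = v
    swap
    · rw [Multiset.count_eq_zero_of_notMem]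
      · exact Nat.zero_le _
      · simpa only [Multiset.mem_map, Finset.mem_val, Finset.mem_univ, true_and] using hv
    obtain ⟨i, hi⟩ := hv
    have hroot : f.IsRoot v := by rw [← hi]; exact hr i
    have hpos : 0 < f.rootMultiplicity v := (rootMultiplicity_pos hf0).2 hroot
    have hmul := derivative_rootMultiplicity_of_root hroot
    rw [← count_roots, hroots] at hmul
    have hA : ∀ {m : ℕ} (g : Fin m → ℝ), Multiset.count v (Finset.univ.val.map g)
        = (Finset.univ.filter fun i => g i = v).card := by
      intro m g
      rw [Multiset.count_map, Finset.card_def, Finset.filter_val]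
      simp only [eq_comm]
    rw [hA] at hmul ⊢
    set A := Finset.univ.filter fun i => r i = v with hAdef
    have hne : A.Nonempty := ⟨i, by simp [hAdef, hi]⟩
    have hmin := A.min'_mem hne
    -- Every index of `A` but the smallest is some `j + 1` with `v ≤ r j ≤ c j ≤ r (j + 1) = v`.
    have hsub : A.erase (A.min' hne) ⊆
        (Finset.univ.filter fun j => c j = v).image Fin.succ := by
      intro l hl
      obtain ⟨hl1, hl2⟩ := Finset.mem_erase.1 hl
      have hlt : A.min' hne < l := lt_of_le_of_ne (A.min'_le l hl2) (Ne.symm hl1)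
      obtain ⟨j, rfl⟩ : ∃ j : Fin n, j.succ = l := Fin.exists_succ_eq.2 (Fin.ne_zero_of_lt hlt)
      refine Finset.mem_image.2 ⟨j, ?_, rfl⟩
      simp only [Finset.mem_filter, Finset.mem_univ, true_and, hAdef] at hmin hl2 ⊢
      have hle : A.min' hne ≤ j.castSucc := Fin.le_castSucc_iff.2 hlt
      have := hmono hle
      exact le_antisymm (hl2 ▸ h₂ j) (by rw [hmin] at this; exact this.trans (h₁ j))
    have hcard := (Finset.card_le_card hsub).trans Finset.card_image_le
    rw [Finset.card_erase_of_mem hmin] at hcard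
    omega
  rw [splits_iff_card_roots]
  apply le_antisymm (card_roots' f)
  rw [hdeg]
  simpa using Multiset.card_le_card hle

theorem exists_root_of_opposite_signs (f : ℝ[X]) {a b : ℝ} (hab : a ≤ b)
    (h : f.eval a * f.eval b ≤ 0) : ∃ r, a ≤ r ∧ r ≤ b ∧ f.eval r = 0 := by
  have hcont : ContinuousOn (fun x => f.eval x) (Set.Icc a b) := f.continuous.continuousOn
  rcases le_total (f.eval a) 0 with ha | ha
  · rcases le_or_gt 0 (f.eval b) with hb | hb
    · obtain ⟨r, hr, h0⟩ := intermediate_value_Icc hab hcont ⟨ha, hb⟩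
      exact ⟨r, hr.1, hr.2, h0⟩
    · exact ⟨a, le_rfl, hab, by nlinarith⟩
  · rcases le_or_gt (f.eval b) 0 with hb | hb
    · obtain ⟨r, hr, h0⟩ := intermediate_value_Icc' hab hcont ⟨hb, ha⟩
      exact ⟨r, hr.1, hr.2, h0⟩
    · exact ⟨a, le_rfl, hab, by nlinarith⟩

theorem exists_ge_eval_nonneg {f : ℝ[X]} (hdeg : 0 < f.natDegree) (hlc : 0 < f.leadingCoeff)
    (M : ℝ) : ∃ U, M ≤ U ∧ 0 ≤ f.eval U := by
  have h := f.tendsto_atTop_of_leadingCoeff_nonneg (natDegree_pos_iff_degree_pos.1 hdeg) hlc.le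
  obtain ⟨U, h1, h2⟩ :=
    ((Filter.eventually_ge_atTop M).and (h.eventually (Filter.eventually_ge_atTop 0))).exists
  exact ⟨U, h1, h2⟩

/-- Reflection `x ↦ -x` reduces this to the behaviour at `+∞`. -/
theorem exists_le_eval_sign {f : ℝ[X]} (hdeg : 0 < f.natDegree) (hlc : 0 < f.leadingCoeff)
    (M : ℝ) : ∃ L, L ≤ M ∧ 0 ≤ (-1) ^ f.natDegree * f.eval L := by
  have hnd : (C ((-1 : ℝ) ^ f.natDegree) * f.comp (-X)).natDegree = f.natDegree := by
    rw [natDegree_C_mul (by simp)]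
    simp [natDegree_comp]
  have hl : (C ((-1 : ℝ) ^ f.natDegree) * f.comp (-X)).leadingCoeff = f.leadingCoeff := by
    rw [leadingCoeff_mul, leadingCoeff_C, leadingCoeff_comp (by simp)]
    simp only [leadingCoeff_neg, leadingCoeff_X]
    rw [mul_comm, mul_assoc, ← mul_pow]
    simp
  obtain ⟨U, h1, h2⟩ := exists_ge_eval_nonneg (f := C ((-1 : ℝ) ^ f.natDegree) * f.comp (-X))
    (by rwa [hnd]) (by rwa [hl]) (-M)
  exact ⟨-U, by linarith, by simpa using h2⟩

theorem splits_of_alternating {n : ℕ} {f : ℝ[X]} (hdeg : f.natDegree = n + 1)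
    (hlc : 0 < f.leadingCoeff) {k : ℝ} {c : Fin n → ℝ} (hc : Monotone c)
    (hf' : f.derivative = C k * ∏ i, (X - C (c i)))
    (hs : ∀ i : Fin n, 0 ≤ (-1) ^ (n + (i : ℕ)) * f.eval (c i)) : f.Splits := by
  obtain ⟨B, hB⟩ : ∃ B, ∀ i, |c i| ≤ B :=
    ⟨∑ i, |c i|, fun i => Finset.single_le_sum (fun j _ => abs_nonneg (c j)) (Finset.mem_univ i)⟩
  obtain ⟨U, hU, hU'⟩ := exists_ge_eval_nonneg (by omega) hlc (max B 0)
  obtain ⟨L, hL, hL'⟩ := exists_le_eval_sign (by omega) hlc (min (-B) 0)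
  have hU1 : ∀ i, c i ≤ U := fun i => (le_abs_self _).trans ((hB i).trans ((le_max_left _ _).trans hU))
  have hL1 : ∀ i, L ≤ c i := fun i => by
    have := neg_abs_le (c i); have := hB i; have := hL.trans (min_le_left _ _); linarith
  have hLU : L ≤ U := (hL.trans (min_le_right _ _)).trans ((le_max_right _ _).trans hU)
  -- The `n` critical points, with `L` and `U` added at the ends, bound `n + 1` consecutive
  -- intervals `[lo i, hi i]`; `f` has weakly opposite signs at the two ends of each.
  let lo : Fin (n + 1) → ℝ := Fin.cons L c
  let hi : Fin (n + 1) → ℝ := Fin.snoc c U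
  have hlo : ∀ i : Fin (n + 1), 0 ≤ (-1) ^ (n + 1 + (i : ℕ)) * f.eval (lo i) := by
    intro i
    refine Fin.cases ?_ (fun j => ?_) i
    · simpa [lo, hdeg] using hL'
    · have := hs j
      simp only [lo, Fin.cons_succ, Fin.val_succ]
      rw [show n + 1 + ((j : ℕ) + 1) = n + j + 2 by ring, pow_add]
      simpa using this
  have hhi : ∀ i : Fin (n + 1), 0 ≤ (-1) ^ (n + (i : ℕ)) * f.eval (hi i) := by
    intro i
    refine Fin.lastCases ?_ (fun j => ?_) i
    · simp only [hi, Fin.snoc_last, Fin.val_last]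
      rw [Even.neg_one_pow ⟨n, rfl⟩, one_mul]
      exact hU'
    · simpa [hi] using hs j
  have hle : ∀ i, lo i ≤ hi i := by
    intro i
    induction i using Fin.cases with
    | zero =>
      show L ≤ hi 0
      have : ∀ i, L ≤ hi i := fun i => by
        refine Fin.lastCases ?_ (fun j => ?_) i
        · simpa [hi] using hLU
        · simpa [hi] using hL1 j
      exact this 0
    | succ j =>
      simp only [lo, Fin.cons_succ]
      have : ∀ i : Fin (n + 1), j.castSucc < i → c j ≤ hi i := fun i => by
        refine Fin.lastCases ?_ (fun m => ?_) i
        · intro _; simpa [hi] using hU1 j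
        · intro h; simpa [hi] using hc (Fin.castSucc_lt_castSucc_iff.1 h).le
      exact this _ Fin.castSucc_lt_succ
  have hroot : ∀ i, ∃ r, lo i ≤ r ∧ r ≤ hi i ∧ f.eval r = 0 := fun i => by
    refine exists_root_of_opposite_signs f (hle i) ?_
    have h1 := mul_nonneg (hlo i) (hhi i)
    have h2 : ((-1 : ℝ) ^ (n + (i : ℕ))) ^ 2 = 1 := by
      rw [← pow_mul, mul_comm, pow_mul]; simp
    rw [show n + 1 + (i : ℕ) = (n + i) + 1 by ring, pow_succ] at h1
    nlinarith
  choose r hr1 hr2 hr3 using hroot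
  refine splits_of_interlacing hdeg hf' hr3 (fun j => ?_) (fun j => ?_)
  · simpa [hi] using hr2 j.castSucc
  · simpa [lo] using hr1 j.succ

theorem eval_derivative_prod_X_sub_C {n : ℕ} (c : Fin n → ℝ) (i : Fin n) :
    (∏ j, (X - C (c j))).derivative.eval (c i) = ∏ j ∈ Finset.univ.erase i, (c i - c j) := by
  rw [derivative_prod_finset, eval_finsetSum, Finset.sum_eq_single i]
  · simp [eval_prod]
  · intro b _ hb
    simp only [derivative_sub, derivative_X, derivative_C, sub_zero, mul_one, eval_prod, eval_sub,
      eval_X, eval_C]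
    exact Finset.prod_eq_zero (Finset.mem_erase.2 ⟨hb.symm, Finset.mem_univ i⟩) (sub_self _)
  · simp

/-- The negative contributions come from the `n - 1 - i` indices above `i`, and this number has the
parity of `n + 1 + i`. -/
theorem prod_sub_sign {n : ℕ} {c : Fin n → ℝ} (hc : Monotone c) (i : Fin n) :
    0 ≤ (-1) ^ (n + 1 + (i : ℕ)) * ∏ j ∈ Finset.univ.erase i, (c i - c j) := by
  have hsplit : (Finset.univ.erase i : Finset (Fin n)) = Finset.Iio i ∪ Finset.Ioi i := by
    ext j
    simp only [Finset.mem_erase, Finset.mem_univ, and_true, Finset.mem_union, Finset.mem_Iio,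
      Finset.mem_Ioi]
    exact ne_iff_lt_or_gt
  have hdisj : Disjoint (Finset.Iio i) (Finset.Ioi i) :=
    Finset.disjoint_left.2 fun j h1 h2 =>
      lt_asymm (Finset.mem_Iio.1 h1) (Finset.mem_Ioi.1 h2)
  rw [hsplit, Finset.prod_union hdisj]
  have h1 : ∏ j ∈ Finset.Ioi i, (c i - c j)
      = (-1) ^ (n - 1 - (i : ℕ)) * ∏ j ∈ Finset.Ioi i, (c j - c i) := by
    rw [← Fin.card_Ioi i, ← Finset.prod_const, ← Finset.prod_mul_distrib]
    exact Finset.prod_congr rfl fun j _ => by ring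
  have h2 : 0 ≤ ∏ j ∈ Finset.Ioi i, (c j - c i) :=
    Finset.prod_nonneg fun j hj => sub_nonneg.2 (hc (Finset.mem_Ioi.1 hj).le)
  have h3 : 0 ≤ ∏ j ∈ Finset.Iio i, (c i - c j) :=
    Finset.prod_nonneg fun j hj => sub_nonneg.2 (hc (Finset.mem_Iio.1 hj).le)
  have h4 : (-1 : ℝ) ^ (n + 1 + (i : ℕ)) * (-1) ^ (n - 1 - (i : ℕ)) = 1 := by
    rw [← pow_add]
    have := i.2
    exact Even.neg_one_pow ⟨n, by omega⟩
  rw [h1]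
  calc (0 : ℝ) ≤ (∏ j ∈ Finset.Iio i, (c i - c j)) * ∏ j ∈ Finset.Ioi i, (c j - c i) :=
        mul_nonneg h3 h2
    _ = ((-1 : ℝ) ^ (n + 1 + (i : ℕ)) * (-1) ^ (n - 1 - (i : ℕ))) *
        ((∏ j ∈ Finset.Iio i, (c i - c j)) * ∏ j ∈ Finset.Ioi i, (c j - c i)) := by
        rw [h4, one_mul]
    _ = _ := by ring

/-- A real polynomial with positive leading coefficient and only real critical points has only
real roots if and only if its critical values alternate in sign. -/
theorem splits_iff_alternating {n : ℕ} {f : ℝ[X]} (hdeg : f.natDegree = n + 1)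
    (hlc : 0 < f.leadingCoeff) {k : ℝ} (hk : 0 < k) {c : Fin n → ℝ} (hc : Monotone c)
    (hf' : f.derivative = C k * ∏ i, (X - C (c i))) :
    f.Splits ↔ ∀ i : Fin n, 0 ≤ (-1) ^ (n + (i : ℕ)) * f.eval (c i) := by
  refine ⟨fun hf i => ?_, splits_of_alternating hdeg hlc hc hf'⟩
  have hcrit : f.derivative.eval (c i) = 0 := by
    rw [hf', eval_mul, eval_prod, Finset.prod_eq_zero (Finset.mem_univ i) (by simp), mul_zero]
  -- At a repeated critical point `f''` vanishes, so only the first alternative can occur; otherwise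
  -- the sign of `f''` is known and forces that of `f`.
  rcases laguerre_critical hf (by omega) hcrit with h | h
  · simp [h]
  · have h2 : f.derivative.derivative.eval (c i)
        = k * ∏ j ∈ Finset.univ.erase i, (c i - c j) := by
      rw [hf', derivative_C_mul, eval_mul, eval_C, eval_derivative_prod_X_sub_C]
    have h3 := prod_sub_sign hc i
    rw [h2] at h
    set P := ∏ j ∈ Finset.univ.erase i, (c i - c j)
    rw [show n + 1 + (i : ℕ) = (n + i) + 1 by ring, pow_succ] at h3
    rcases neg_one_pow_eq_or ℝ (n + (i : ℕ)) with he | he <;> rw [he] at h3 ⊢ <;>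
      by_contra! hneg
    · have : 0 ≤ (-f.eval (c i)) * (k * -P) :=
        mul_nonneg (by linarith) (mul_nonneg hk.le (by linarith))
      linarith
    · have : 0 ≤ f.eval (c i) * (k * P) :=
        mul_nonneg (by linarith) (mul_nonneg hk.le (by linarith))
      linarith

theorem splits_iff_forall_complex_root {f : ℝ[X]} (hf : f ≠ 0) : f.Splits ↔ AllRootsReal f := by
  constructor
  · intro h z hz
    obtain ⟨r, hr⟩ := h.mem_range_of_isRoot (S := ℂ) (i := algebraMap ℝ ℂ) hf (x := z)
      (by rwa [IsRoot, eval_map_algebraMap])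
    exact ⟨r, by simpa using hr.symm⟩
  · intro h
    refine Splits.of_splits_map (algebraMap ℝ ℂ) (IsAlgClosed.splits _) fun z hz => ?_
    obtain ⟨r, hr⟩ := h z (by
      rw [mem_roots', IsRoot, eval_map_algebraMap] at hz
      exact hz.2)
    exact ⟨r, by simp [hr]⟩

end RealRooted

theorem exists_isSortedReal {ι : Type} {n : ℕ} (e : Fin n ≃ ι) {s : ι → ℂ}
    (hs : ∀ i, ∃ r : ℝ, s i = r) : ∃ t : Fin n → ℝ, IsSortedReal s t := by
  choose r hr using hs
  exact ⟨(r ∘ e) ∘ Tuple.sort (r ∘ e), Tuple.monotone_sort _, (Tuple.sort (r ∘ e)).trans e,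
    fun i => hr _⟩

/-! ### Cardano's formula when the discriminant condition holds -/

section Cardano

theorem conj_eq_neg_of_sq_nonpos {δ : ℂ} {d : ℝ} (hd : d ≤ 0) (h : δ ^ 2 = d) :
    (starRingEnd ℂ) δ = -δ := by
  have h1 := congrArg Complex.re h
  have h2 := congrArg Complex.im h
  simp only [pow_two, Complex.mul_re, Complex.mul_im, Complex.ofReal_re, Complex.ofReal_im] at h1 h2
  have hre : δ.re = 0 := by
    rcases mul_eq_zero.1 (show δ.re * δ.im = 0 by linarith) with h0 | h0
    · exact h0
    · rw [h0] at h1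
      nlinarith
  apply Complex.ext <;> simp [hre]

/-- For `Δ ≤ 0` the root `δ` is purely imaginary, so the conjugate of `ω` is a cube root of `(-q -
δ) / 2`. It is the matching one, since `ω * conj ω` is real with cube `(-p / 3)³`. Hence `ρ k = 2 Re
(ζ ^ k ω)` are the roots of `x³ + p x + q`. By `ρ³ = -p ρ - q`, the expression `p ρ² + 3 q ρ` equals
`ρ⁴ + 2 p ρ² + 4 q ρ`. -/
theorem IsCardanoFamily.exists_real_roots {p q : ℝ} {S : Fin 3 → ℂ} (hS : IsCardanoFamily p q S)
    (hΔ : q ^ 2 + 4 / 27 * p ^ 3 ≤ 0) :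
    ∃ ρ : Fin 3 → ℝ, ρ 0 + ρ 1 + ρ 2 = 0 ∧ ρ 0 * ρ 1 + ρ 0 * ρ 2 + ρ 1 * ρ 2 = p ∧
      ρ 0 * ρ 1 * ρ 2 = -q ∧ ∀ k, S k = ((-(p * ρ k ^ 2 + 3 * q * ρ k) : ℝ) : ℂ) := by
  obtain ⟨δ, ζ, ω, hδ, hζ, hω, hS⟩ := hS
  have hδc : (starRingEnd ℂ) δ = -δ :=
    conj_eq_neg_of_sq_nonpos hΔ (by rw [hδ]; push_cast; ring)
  have hζ3 : ζ ^ 3 = 1 := hζ.pow_eq_one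
  have hζ0 : ζ ≠ 0 := hζ.ne_zero (by norm_num)
  have hζc : (starRingEnd ℂ) ζ = ζ⁻¹ :=
    (Complex.inv_eq_conj (hζ.norm'_eq_one (by norm_num))).symm
  have hζinv : ζ⁻¹ = ζ ^ 2 := by
    field_simp
    exact hζ3.symm
  have hζsum : ζ ^ 2 + ζ + 1 = 0 := by
    have h1 : ζ ≠ 1 := hζ.ne_one (by norm_num)
    have h2 : (ζ - 1) * (ζ ^ 2 + ζ + 1) = 0 := by linear_combination hζ3
    exact (mul_eq_zero.1 h2).resolve_left (sub_ne_zero.2 h1)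
  have hωc : (starRingEnd ℂ) ω ^ 3 = 1 / 2 * (-(q : ℂ) - δ) := by
    rw [← map_pow, hω]
    simp [hδc, sub_eq_add_neg, Complex.conj_ofNat]
  have hprod : ω * (starRingEnd ℂ) ω = -(p : ℂ) / 3 := by
    rw [Complex.mul_conj]
    have h1 : ((Complex.normSq ω : ℝ) : ℂ) ^ 3 = ((-p / 3 : ℝ) : ℂ) ^ 3 := by
      rw [← Complex.mul_conj, mul_pow, hω, hωc]
      push_cast
      linear_combination (-1 / 4 : ℂ) * hδ
    have h2 : Complex.normSq ω = -p / 3 := by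
      have h3 : Complex.normSq ω ^ 3 = (-p / 3) ^ 3 := by exact_mod_cast h1
      exact (Odd.strictMono_pow (by decide : Odd 3)).injective h3
    rw [h2]
    push_cast
    ring
  set B := (starRingEnd ℂ) ω with hB
  obtain ⟨ρ, hρ⟩ : ∃ ρ : Fin 3 → ℝ, ∀ k, (ρ k : ℂ) = ζ ^ (k : ℕ) * ω + ζ⁻¹ ^ (k : ℕ) * B :=
    ⟨fun k => 2 * (ζ ^ (k : ℕ) * ω).re, fun k => by
      rw [← hζc, hB, ← map_pow, ← map_mul, Complex.add_conj]⟩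
  have h0 : (ρ 0 : ℂ) = ω + B := by simpa using hρ 0
  have h1 : (ρ 1 : ℂ) = ζ * ω - (1 + ζ) * B := by
    have := hρ 1
    simp only [Fin.val_one, pow_one, hζinv] at this
    linear_combination this + B * hζsum
  have h2 : (ρ 2 : ℂ) = -(1 + ζ) * ω + ζ * B := by
    have := hρ 2
    simp only [Fin.val_two, hζinv] at this
    linear_combination this + ω * hζsum + B * ζ * hζ3
  refine ⟨ρ, ?_, ?_, ?_, fun k => ?_⟩
  · apply Complex.ofReal_injective
    push_cast
    rw [h0, h1, h2]
    ring
  · apply Complex.ofReal_injective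
    push_cast
    rw [h0, h1, h2]
    linear_combination -3 * hprod + (-(ω ^ 2 + B ^ 2) + 2 * ω * B) * hζsum
  · apply Complex.ofReal_injective
    push_cast
    rw [h0, h1, h2]
    linear_combination hω + hωc + (ω + B) * (2 * ω * B - ω ^ 2 - B ^ 2) * hζsum
  · rw [hS k]
    have hA : (ζ ^ (k : ℕ) * ω) ^ 3 = 1 / 2 * (-(q : ℂ) + δ) := by
      rw [mul_pow, ← pow_mul, mul_comm (k : ℕ) 3, pow_mul, hζ3, one_pow, one_mul, hω]
    have hB' : (ζ⁻¹ ^ (k : ℕ) * B) ^ 3 = 1 / 2 * (-(q : ℂ) - δ) := by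
      rw [mul_pow, ← pow_mul, mul_comm (k : ℕ) 3, pow_mul, inv_pow, hζ3, inv_one, one_pow, one_mul,
        hωc]
    have hAB : (ζ ^ (k : ℕ) * ω) * (ζ⁻¹ ^ (k : ℕ) * B) = -(p : ℂ) / 3 := by
      rw [← hprod, mul_mul_mul_comm, ← mul_pow, mul_inv_cancel₀ hζ0, one_pow, one_mul]
    push_cast
    rw [hρ k]
    set A := ζ ^ (k : ℕ) * ω
    set B' := ζ⁻¹ ^ (k : ℕ) * B
    linear_combination (3 * (A ^ 2 + B' ^ 2) + 2 * p) * hAB - 3 * B' * hA - 3 * A * hB'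

end Cardano

/-! ### Ferrari's formula -/

section Ferrari

/-- A product identity keeps track of multiplicities. For `q ≠ 0` it is the factorization `(z² + y +
p)² - (w z - g)²` with `w² = 2 y` and `g w = 2 q`; the resolvent cubic says that the constant term
is `r`. -/
theorem IsFerrariFamily.prod_sub {p q r : ℝ} {x : ℤˣ → ℤˣ → ℂ} (hx : IsFerrariFamily p q r x)
    (z : ℂ) : (z - x 1 1) * (z - x 1 (-1)) * ((z - x (-1) 1) * (z - x (-1) (-1)))
      = z ^ 4 + 2 * p * z ^ 2 + 4 * q * z + r := by
  by_cases hq : q = 0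
  · obtain ⟨s, t, hs, ht, hx⟩ := hx.1 hq
    have h1 := ht 1
    have h2 := ht (-1)
    simp only [Units.val_one, Int.cast_one, one_mul, Units.val_neg, Int.cast_neg, neg_mul] at h1 h2
    simp only [hx, Units.val_one, Int.cast_one, one_mul, Units.val_neg, Int.cast_neg, neg_mul, hq,
      Complex.ofReal_zero, mul_zero, zero_mul, add_zero]
    linear_combination (-z ^ 2 + t (-1) ^ 2) * h1 + (-z ^ 2 - p + s) * h2 - hs
  · obtain ⟨d, c, y, w, t, hd, hc0, hc1, hy, hw, ht, hx⟩ := hx.2 hq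
    have hres : y * (y + p) ^ 2 - 2 * q ^ 2 - r * y = 0 := by
      have hv3 : (v₃ p q r : ℂ) = 2 * p * r / 3 - 2 * p ^ 3 / 27 - 2 * q ^ 2 := by
        simp [v₃]
      have hv2 : (v₂ p r : ℂ) = -(p ^ 2 / 3) - r := by simp [v₂]
      have hcub : (y + 2 * p / 3) ^ 3 + v₂ p r * (y + 2 * p / 3) + v₃ p q r = 0 := by
        rw [hy]
        by_cases hv : v₂ p r = 0
        · have := hc0 hv
          simp only [hv, Complex.ofReal_zero, zero_div, sub_zero, zero_mul]
          linear_combination this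
        · have h3 := hc1 hv
          have hc : c ≠ 0 := by
            rintro rfl
            apply hv
            have hdv : d = v₃ p q r := by linear_combination -2 * h3
            rw [hdv] at hd
            have h4 : (v₂ p r : ℂ) ^ 3 = 0 := by linear_combination (-27 / 4 : ℂ) * hd
            exact_mod_cast pow_eq_zero_iff (three_ne_zero) |>.1 h4
          -- `-e` is the companion Cardano cube root: `3 c e = v₂` and `e³ = (v₃ + d) / 2`, so `c -
          -- e` solves the depressed resolvent.
          obtain ⟨e, he⟩ : ∃ e, e = (v₂ p r : ℂ) / (3 * c) := ⟨_, rfl⟩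
          have hce : 3 * c * e = v₂ p r := by rw [he]; field_simp
          rw [← he]
          have h5 : e ^ 3 = 1 / 2 * (v₃ p q r + d) := by
            have h6 : c ^ 3 * (e ^ 3 - 1 / 2 * (v₃ p q r + d)) = 0 := by
              rw [← hce] at hd
              linear_combination (-1 / 2 * (v₃ p q r + d)) * h3 - 1 / 4 * hd
            exact sub_eq_zero.1 ((mul_eq_zero.1 h6).resolve_left (pow_ne_zero 3 hc))
          linear_combination h3 - h5 - (c - e) * hce
      rw [hv2, hv3] at hcub
      linear_combination hcub
    have hqc : (q : ℂ) ≠ 0 := by exact_mod_cast hq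
    -- If `y` were `0`, the resolvent would give `q = 0`.
    have hw0 : w ≠ 0 := by
      rintro rfl
      have hy0 : y = 0 := by linear_combination (-1 / 2 : ℂ) * hw
      rw [hy0] at hres
      apply hqc
      have : (q : ℂ) ^ 2 = 0 := by linear_combination (-1 / 2 : ℂ) * hres
      exact pow_eq_zero_iff (two_ne_zero) |>.1 this
    have h1 := ht 1
    have h2 := ht (-1)
    simp only [Units.val_one, Int.cast_one, one_mul, Units.val_neg, Int.cast_neg, neg_mul] at h1 h2
    simp only [hx, Units.val_one, Int.cast_one, one_mul, Units.val_neg, Int.cast_neg, neg_mul]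
    obtain ⟨g, hg⟩ : ∃ g, g = 2 * (q : ℂ) / w := ⟨_, rfl⟩
    have hgw : g * w = 2 * q := by rw [hg]; field_simp
    have h8 : 8 * (q : ℂ) / w = 4 * g := by rw [hg]; ring
    rw [h8] at h1 h2
    have hr : (y + p) ^ 2 - g ^ 2 = r := by
      have : w ^ 2 * ((y + p) ^ 2 - g ^ 2 - r) = 0 := by
        rw [hw]; linear_combination 2 * hres - (g * w + 2 * q) * hgw + g ^ 2 * hw
      have := (mul_eq_zero.1 this).resolve_left (pow_ne_zero 2 hw0)
      linear_combination this
    have e1 : (z - (w + t 1) / 2) * (z - (w + -t 1) / 2) = z ^ 2 - w * z + (y + p + g) := by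
      linear_combination (-1 / 4 : ℂ) * h1 + (1 / 4 : ℂ) * hw
    have e2 : (z - (-w + t (-1)) / 2) * (z - (-w + -t (-1)) / 2)
        = z ^ 2 + w * z + (y + p - g) := by
      linear_combination (-1 / 4 : ℂ) * h2 + (1 / 4 : ℂ) * hw
    rw [e1, e2]
    linear_combination hr - z ^ 2 * hw + 2 * z * hgw

theorem prod_signs (F : ℤˣ × ℤˣ → ℂ) :
    ∏ i, F i = F (1, 1) * F (1, -1) * (F (-1, 1) * F (-1, -1)) := by
  rw [Fintype.prod_prod_type]
  simp only [show (Finset.univ : Finset ℤˣ) = {1, -1} from rfl]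
  rw [Finset.prod_pair (by decide), Finset.prod_pair (by decide), Finset.prod_pair (by decide)]

noncomputable def signsEquiv : Fin 4 ≃ ℤˣ × ℤˣ :=
  Fintype.equivOfCardEq (by simp [Fintype.card_prod, Fintype.card_units_int])

end Ferrari

/-! ### The chain cubic, quartic, quintic -/

noncomputable def depressedCubic (p q : ℝ) : ℝ[X] := X ^ 3 + C p * X + C q

noncomputable def depressedQuartic (p q r : ℝ) : ℝ[X] :=
  X ^ 4 + C (2 * p) * X ^ 2 + C (4 * q) * X + C r

theorem depressedCubic_natDegree (p q : ℝ) : (depressedCubic p q).natDegree = 3 := by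
  unfold depressedCubic; compute_degree!

theorem depressedCubic_monic (p q : ℝ) : (depressedCubic p q).Monic := by
  unfold depressedCubic; monicity!

theorem depressedQuartic_natDegree (p q r : ℝ) : (depressedQuartic p q r).natDegree = 4 := by
  unfold depressedQuartic; compute_degree!

theorem depressedQuartic_monic (p q r : ℝ) : (depressedQuartic p q r).Monic := by
  unfold depressedQuartic; monicity!

theorem quintic_natDegree (a₀ a₁ a₂ a₃ a₄ : ℝ) : (quintic a₀ a₁ a₂ a₃ a₄).natDegree = 5 := by
  unfold quintic; compute_degree!

theorem quintic_monic (a₀ a₁ a₂ a₃ a₄ : ℝ) : (quintic a₀ a₁ a₂ a₃ a₄).Monic := by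
  unfold quintic; monicity!

theorem eval_depressedCubic (p q x : ℝ) :
    (depressedCubic p q).eval x = x ^ 3 + p * x + q := by
  simp [depressedCubic]

theorem eval_depressedQuartic (p q r x : ℝ) :
    (depressedQuartic p q r).eval x = x ^ 4 + 2 * p * x ^ 2 + 4 * q * x + r := by
  simp [depressedQuartic]

theorem eval_quintic (a₀ a₁ a₂ a₃ a₄ x : ℝ) :
    (quintic a₀ a₁ a₂ a₃ a₄).eval x
      = x ^ 5 + a₄ * x ^ 4 + a₃ * x ^ 3 + a₂ * x ^ 2 + a₁ * x + a₀ := by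
  simp [quintic]

theorem depressedQuartic_derivative (p q r : ℝ) :
    (depressedQuartic p q r).derivative = C 4 * depressedCubic p q := by
  apply Polynomial.funext
  intro x
  simp [depressedQuartic, depressedCubic]
  ring

theorem quintic_derivative (a₀ a₁ a₂ a₃ a₄ : ℝ) :
    (quintic a₀ a₁ a₂ a₃ a₄).derivative
      = C 5 * (depressedQuartic (u₂ a₃ a₄) (u₃ a₂ a₃ a₄) (u₄ a₁ a₂ a₃ a₄)).comp
        (X + C (a₄ / 5)) := by
  apply Polynomial.funext
  intro x
  rw [eval_mul, eval_C, eval_comp, eval_depressedQuartic]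
  simp [quintic, u₂, u₃, u₄]
  ring

theorem depressedQuartic_splits_of_quintic {a₀ a₁ a₂ a₃ a₄ : ℝ}
    (h : (quintic a₀ a₁ a₂ a₃ a₄).Splits) :
    (depressedQuartic (u₂ a₃ a₄) (u₃ a₂ a₃ a₄) (u₄ a₁ a₂ a₃ a₄)).Splits := by
  have h1 := splits_derivative h
  rw [quintic_derivative, splits_mul_iff_right (by simp) (Splits.C 5)] at h1
  exact (splits_iff_comp_splits_of_natDegree_eq_one (natDegree_X_add_C _)).2 h1

theorem depressedCubic_splits_of_quartic {p q r : ℝ} (h : (depressedQuartic p q r).Splits) :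
    (depressedCubic p q).Splits := by
  have h1 := splits_derivative h
  rwa [depressedQuartic_derivative, splits_mul_iff_right (by simp) (Splits.C 4)] at h1

theorem depressedCubic_vieta {p q a b c : ℝ}
    (h : ∀ x : ℝ, x ^ 3 + p * x + q = (x - a) * (x - b) * (x - c)) :
    a + b + c = 0 ∧ a * b + a * c + b * c = p ∧ a * b * c = -q := by
  have h0 := h 0
  have h1 := h 1
  have h2 := h (-1)
  refine ⟨?_, ?_, ?_⟩ <;> linarith

/-- `-(4 p³ + 27 q²)` is the square of the product of the root differences, which for `c = -a - b`
is `(a - b) (2 a + b) (a + 2 b)`. -/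
theorem discriminant_nonpos_of_splits {p q : ℝ} (h : (depressedCubic p q).Splits) :
    q ^ 2 + 4 / 27 * p ^ 3 ≤ 0 := by
  have hcard := h.natDegree_eq_card_roots
  rw [depressedCubic_natDegree] at hcard
  obtain ⟨a, b, c, habc⟩ := Multiset.card_eq_three.1 hcard.symm
  have heval := h.eval_eq_prod_roots_of_monic (depressedCubic_monic p q)
  obtain ⟨h1, h2, h3⟩ := depressedCubic_vieta (p := p) (q := q) (a := a) (b := b) (c := c) fun x => by
    rw [← eval_depressedCubic, heval, habc]
    simp [mul_assoc]
  obtain rfl : c = -a - b := by linarith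
  obtain rfl : q = -(a * b * (-a - b)) := by linarith
  rw [← h2]
  nlinarith [sq_nonneg ((a - b) * (2 * a + b) * (a + 2 * b))]

/-- With `m = 4/25 a₄² - 2/5 a₃` one has `u₂ = -(3/4) m`, so the right side is `(4 u₃)² ≤ m³`, that
is `m ≥ 0` and `|4 u₃| ≤ m ^ (3/2)`; moreover `a₂` is `10 u₃` plus the centre of the interval. -/
theorem coefficient_bounds_iff (a₂ a₃ a₄ : ℝ) :
    (a₃ ≤ 2 / 5 * a₄ ^ 2 ∧
      (3 / 5 * a₃ * a₄ - 4 / 25 * a₄ ^ 3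
          - 5 / 2 * (4 / 25 * a₄ ^ 2 - 2 / 5 * a₃) ^ (3 / 2 : ℝ) ≤ a₂ ∧
        a₂ ≤ 3 / 5 * a₃ * a₄ - 4 / 25 * a₄ ^ 3
          + 5 / 2 * (4 / 25 * a₄ ^ 2 - 2 / 5 * a₃) ^ (3 / 2 : ℝ))) ↔
      u₃ a₂ a₃ a₄ ^ 2 + 4 / 27 * u₂ a₃ a₄ ^ 3 ≤ 0 := by
  have hm : u₂ a₃ a₄ = -(3 / 4) * (4 / 25 * a₄ ^ 2 - 2 / 5 * a₃) := by
    unfold u₂; ring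
  have hq : a₂ = 10 * u₃ a₂ a₃ a₄ + (3 / 5 * a₃ * a₄ - 4 / 25 * a₄ ^ 3) := by
    unfold u₃; ring
  have hle : a₃ ≤ 2 / 5 * a₄ ^ 2 ↔ 0 ≤ 4 / 25 * a₄ ^ 2 - 2 / 5 * a₃ := by
    constructor <;> intro h <;> linarith
  rw [hle, hm]
  generalize u₃ a₂ a₃ a₄ = q at hq ⊢
  subst hq
  generalize 4 / 25 * a₄ ^ 2 - 2 / 5 * a₃ = m
  have hrpow : 0 ≤ m → 0 ≤ m ^ (3 / 2 : ℝ) ∧ (m ^ (3 / 2 : ℝ)) ^ 2 = m ^ 3 := fun h => by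
    refine ⟨Real.rpow_nonneg h _, ?_⟩
    rw [← Real.rpow_natCast, ← Real.rpow_mul h, ← Real.rpow_natCast]
    norm_num
  generalize m ^ (3 / 2 : ℝ) = w at hrpow
  constructor
  · rintro ⟨h0, h1, h2⟩
    obtain ⟨hw, hw2⟩ := hrpow h0
    have := sq_le_sq' (a := 4 * q) (b := w) (by linarith) (by linarith)
    nlinarith
  · intro h
    have h0 : 0 ≤ m := by
      by_contra! hneg
      have : m ^ 3 < 0 := Odd.pow_neg (by decide) hneg
      nlinarith [sq_nonneg q]
    obtain ⟨hw, hw2⟩ := hrpow h0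
    have := abs_le_of_sq_le_sq' (a := 4 * q) (b := w) (by nlinarith) hw
    exact ⟨h0, by linarith, by linarith⟩

theorem IsCardanoFamily.exists_sorted {p q : ℝ} {S : Fin 3 → ℂ} (hS : IsCardanoFamily p q S)
    (hΔ : q ^ 2 + 4 / 27 * p ^ 3 ≤ 0) :
    ∃ (c : Fin 3 → ℝ) (σ : Equiv.Perm (Fin 3)), Monotone c ∧
      depressedCubic p q = ∏ i, (X - C (c i)) ∧
      ∀ i, S (σ i) = ((-(p * c i ^ 2 + 3 * q * c i) : ℝ) : ℂ) := by
  obtain ⟨ρ, h1, h2, h3, hρ⟩ := hS.exists_real_roots hΔ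
  refine ⟨ρ ∘ Tuple.sort ρ, Tuple.sort ρ, Tuple.monotone_sort ρ, ?_, fun i => hρ _⟩
  simp only [Function.comp_apply]
  rw [Equiv.prod_comp (Tuple.sort ρ) (fun i => X - C (ρ i))]
  apply Polynomial.funext
  intro x
  rw [eval_depressedCubic, eval_prod, Fin.prod_univ_three]
  simp only [eval_sub, eval_X, eval_C]
  linear_combination (-x) * h2 + h3 + x ^ 2 * h1

theorem IsCardanoFamily.exists_isSortedReal {p q : ℝ} {S : Fin 3 → ℂ}
    (hS : IsCardanoFamily p q S) (hΔ : q ^ 2 + 4 / 27 * p ^ 3 ≤ 0) :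
    ∃ θ : Fin 3 → ℝ, IsSortedReal S θ := by
  obtain ⟨ρ, -, -, -, hρ⟩ := hS.exists_real_roots hΔ
  exact MonicQuintic.exists_isSortedReal (Equiv.refl _) fun i => ⟨_, hρ i⟩

/-- As `g 1` is the minimum, it is `θ 0`, and `θ 1` is the smaller of the other two values. The
order of those two is left open. -/
theorem sorted_bounds_iff {S : Fin 3 → ℂ} {g : Fin 3 → ℝ} {σ : Equiv.Perm (Fin 3)}
    (hg : ∀ i, S (σ i) = (g i : ℂ)) (hmin : ∀ i, g 1 ≤ g i) (r : ℝ) :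
    (∃ θ : Fin 3 → ℝ, IsSortedReal S θ ∧ θ 0 ≤ r ∧ r ≤ θ 1) ↔
      g 1 ≤ r ∧ ∀ i, i ≠ 1 → r ≤ g i := by
  have hperm : ∀ {θ : Fin 3 → ℝ} {τ : Fin 3 ≃ Fin 3}, (∀ i, S (τ i) = (θ i : ℂ)) →
      ∀ i, θ i = g ((τ.trans σ.symm) i) := by
    intro θ τ hτ i
    have := hg (σ.symm (τ i))
    rw [Equiv.apply_symm_apply, hτ i] at this
    exact_mod_cast this
  constructor
  · rintro ⟨θ, ⟨hmono, τ, hτ⟩, h0, h1⟩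
    have hπ := hperm hτ
    generalize τ.trans σ.symm = π at hπ
    have hπ' : ∀ i, g i = θ (π.symm i) := fun i => by rw [hπ, Equiv.apply_symm_apply]
    refine ⟨((hmin _).trans (hπ 0).ge).trans h0, fun i hi => ?_⟩
    have hge : ∀ j : Fin 3, j ≠ 0 → θ 1 ≤ θ j := fun j hj => hmono (Fin.one_le_of_ne_zero hj)
    by_cases hj : π.symm i = 0
    · have hj1 : π.symm 1 ≠ 0 := fun h => hi (π.symm.injective (hj.trans h.symm))
      exact ((h1.trans (hge _ hj1)).trans (hπ' 1).ge).trans (hmin i)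
    · exact (h1.trans (hge _ hj)).trans (hπ' i).ge
  · rintro ⟨h1, h2⟩
    obtain ⟨θ, hmono, τ, hτ⟩ := exists_isSortedReal (s := S) (Equiv.refl _) fun i =>
      ⟨g (σ.symm i), by rw [← hg, Equiv.apply_symm_apply]⟩
    have hπ := hperm hτ
    refine ⟨θ, ⟨hmono, τ, hτ⟩, ?_⟩
    generalize τ.trans σ.symm = π at hπ
    constructor
    · calc θ 0 ≤ θ (π.symm 1) := hmono (Fin.zero_le _)
        _ = g 1 := by rw [hπ, Equiv.apply_symm_apply]
        _ ≤ r := h1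
    · by_cases h : π 1 = 1
      · have h0 : π 0 ≠ 1 := fun h' => by simpa using π.injective (h'.trans h.symm)
        exact ((h2 _ h0).trans (hπ 0).ge).trans (hmono (Fin.zero_le _))
      · exact (h2 _ h).trans (hπ 1).ge

theorem depressedQuartic_splits_iff_condSix {a₁ a₂ a₃ a₄ : ℝ} {S : Fin 3 → ℂ}
    (hS : IsCardanoFamily (u₂ a₃ a₄) (u₃ a₂ a₃ a₄) S)
    (hΔ : u₃ a₂ a₃ a₄ ^ 2 + 4 / 27 * u₂ a₃ a₄ ^ 3 ≤ 0) :
    (depressedQuartic (u₂ a₃ a₄) (u₃ a₂ a₃ a₄) (u₄ a₁ a₂ a₃ a₄)).Splits ↔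
      CondSix a₁ a₂ a₃ a₄ S := by
  obtain ⟨c, σ, hc, hcub, hSc⟩ := hS.exists_sorted hΔ
  have ha : a₁ = 5 * u₄ a₁ a₂ a₃ a₄
      + (3 / 125 * a₄ ^ 4 - 3 / 25 * a₄ ^ 2 * a₃ + 2 / 5 * a₂ * a₄) := by
    unfold u₄; ring
  have hsix : CondSix a₁ a₂ a₃ a₄ S ↔ ∃ θ : Fin 3 → ℝ, IsSortedReal S θ ∧
      θ 0 ≤ u₄ a₁ a₂ a₃ a₄ ∧ u₄ a₁ a₂ a₃ a₄ ≤ θ 1 := by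
    unfold CondSix
    refine exists_congr fun θ => and_congr_right fun _ => and_congr ?_ ?_ <;>
      constructor <;> intro h <;> linarith
  rw [hsix]
  generalize u₂ a₃ a₄ = p at *
  generalize u₃ a₂ a₃ a₄ = q at *
  generalize u₄ a₁ a₂ a₃ a₄ = r at *
  have hroots : ∀ x, x ^ 3 + p * x + q = (x - c 0) * (x - c 1) * (x - c 2) := fun x => by
    rw [← eval_depressedCubic, hcub, eval_prod, Fin.prod_univ_three]
    simp
  obtain ⟨e1, e2, e3⟩ := depressedCubic_vieta hroots
  have h01 : c 0 ≤ c 1 := hc (by decide)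
  have h12 : c 1 ≤ c 2 := hc (by decide)
  have hmin : ∀ i, (fun i => -(p * c i ^ 2 + 3 * q * c i)) 1
      ≤ (fun i => -(p * c i ^ 2 + 3 * q * c i)) i := by
    have hq : q = -(c 0 * c 1 * c 2) := by linarith
    simp only [Fin.forall_fin_succ, hq, ← e2]
    have hc2 : c 2 = -c 0 - c 1 := by linarith
    have hc0 : c 0 = -c 1 - c 2 := by linarith
    -- Integrating `4 (x - c 0) (x - c 1) (x - c 2)` between neighbouring roots, with root sum zero,
    -- gives exactly these two products as the differences of values. The outer roots have opposite
    -- signs, again because the sum is zero.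
    have k1 : 0 ≤ c 2 * (c 1 - c 0) ^ 3 :=
      mul_nonneg (by linarith) (pow_nonneg (by linarith) 3)
    have k2 : 0 ≤ -c 0 * (c 2 - c 1) ^ 3 :=
      mul_nonneg (by linarith) (pow_nonneg (by linarith) 3)
    refine ⟨?_, le_rfl, ?_, by simp⟩
    · rw [hc2] at k1 ⊢
      linarith
    · show _ ≤ -((c 0 * c 1 + c 0 * c 2 + c 1 * c 2) * c 2 ^ 2 + 3 * -(c 0 * c 1 * c 2) * c 2)
      rw [hc0] at k2 ⊢
      linarith
  rw [sorted_bounds_iff hSc hmin r,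
    splits_iff_alternating (k := 4) (depressedQuartic_natDegree p q r)
      (by rw [depressedQuartic_monic]; exact one_pos) (by norm_num) hc
      (by rw [depressedQuartic_derivative, hcub])]
  have heval : ∀ i, (depressedQuartic p q r).eval (c i) = r + (p * c i ^ 2 + 3 * q * c i) := by
    intro i
    have h0 : c i ^ 3 + p * c i + q = 0 := by
      rw [← eval_depressedCubic, hcub, eval_prod, Finset.prod_eq_zero (Finset.mem_univ i) (by simp)]
    rw [eval_depressedQuartic]
    linear_combination c i * h0
  simp only [heval, Fin.forall_fin_succ]
  norm_num [Fin.ext_iff]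
  constructor
  · rintro ⟨h1, h2, h3⟩
    refine ⟨?_, ?_, ?_⟩ <;> linarith
  · rintro ⟨h1, h2, h3⟩
    refine ⟨?_, ?_, ?_⟩ <;> linarith

theorem shifted_real_of_splits {a₄ p q r : ℝ} {x : ℤˣ → ℤˣ → ℂ} (hx : IsFerrariFamily p q r x)
    (h : (depressedQuartic p q r).Splits) : ∃ b : Fin 4 → ℝ, IsSortedReal (shifted a₄ x) b := by
  refine exists_isSortedReal signsEquiv fun i => ?_
  have hroot : aeval (x i.1 i.2) (depressedQuartic p q r) = 0 := by
    have h1 := hx.prod_sub (x i.1 i.2)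
    rw [← prod_signs fun j => x i.1 i.2 - x j.1 j.2, Finset.prod_eq_zero (Finset.mem_univ i)
      (sub_self _)] at h1
    rw [h1]
    simp [depressedQuartic]
  obtain ⟨t, ht⟩ :=
    (splits_iff_forall_complex_root (depressedQuartic_monic p q r).ne_zero).1 h _ hroot
  exact ⟨t - a₄ / 5, by simp [shifted, ht]⟩

theorem quintic_derivative_eq_prod {a₁ a₂ a₃ a₄ : ℝ} {x : ℤˣ → ℤˣ → ℂ}
    (hx : IsFerrariFamily (u₂ a₃ a₄) (u₃ a₂ a₃ a₄) (u₄ a₁ a₂ a₃ a₄) x) {b : Fin 4 → ℝ}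
    (hb : IsSortedReal (shifted a₄ x) b) (a₀ : ℝ) :
    (quintic a₀ a₁ a₂ a₃ a₄).derivative = C 5 * ∏ i, (X - C (b i)) := by
  obtain ⟨-, σ, hσ⟩ := hb
  rw [quintic_derivative]
  congr 1
  apply Polynomial.funext
  intro z
  rw [eval_comp, eval_depressedQuartic, eval_prod]
  simp only [eval_add, eval_sub, eval_X, eval_C]
  apply Complex.ofReal_injective
  have h1 := hx.prod_sub (z + a₄ / 5)
  push_cast
  rw [← h1, ← prod_signs fun j => (z : ℂ) + a₄ / 5 - x j.1 j.2, ← Equiv.prod_comp σ]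
  refine Finset.prod_congr rfl fun i _ => ?_
  rw [← hσ i, shifted]
  ring

/-- Alternation at `b 0 ≤ b 1 ≤ b 2 ≤ b 3` means values `≥ 0` at `b 0`, `b 2` and `≤ 0` at `b 1`, `b
3`; the minimum and maximum collect these four inequalities. -/
theorem quintic_splits_iff_condNine {a₀ a₁ a₂ a₃ a₄ : ℝ} {x : ℤˣ → ℤˣ → ℂ}
    (hx : IsFerrariFamily (u₂ a₃ a₄) (u₃ a₂ a₃ a₄) (u₄ a₁ a₂ a₃ a₄) x) :
    (quintic a₀ a₁ a₂ a₃ a₄).Splits ↔ CondNine a₀ a₁ a₂ a₃ a₄ x := by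
  have key : ∀ b : Fin 4 → ℝ, IsSortedReal (shifted a₄ x) b →
      ((quintic a₀ a₁ a₂ a₃ a₄).Splits ↔
        -lam₂ a₁ a₂ a₃ a₄ b ≤ a₀ ∧ a₀ ≤ -lam₁ a₁ a₂ a₃ a₄ b) := by
    intro b hb
    rw [splits_iff_alternating (k := 5) (quintic_natDegree a₀ a₁ a₂ a₃ a₄)
      (by rw [quintic_monic]; exact one_pos) (by norm_num) hb.1
      (quintic_derivative_eq_prod hx hb a₀)]
    have heval : ∀ t, (quintic a₀ a₁ a₂ a₃ a₄).eval t = valueAt a₁ a₂ a₃ a₄ t + a₀ := fun t => by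
      rw [eval_quintic, valueAt]
    rw [neg_le, le_neg]
    simp only [heval, lam₁, lam₂, le_min_iff, max_le_iff, Fin.forall_fin_succ]
    norm_num
    rw [show Fin.succ (2 : Fin 3) = 3 from rfl]
    constructor
    · rintro ⟨h0, h1, h2, h3⟩
      refine ⟨⟨?_, ?_⟩, ?_, ?_⟩ <;> linarith
    · rintro ⟨⟨h2, h0⟩, h3, h1⟩
      refine ⟨?_, ?_, ?_, ?_⟩ <;> linarith
  constructor
  · intro h
    obtain ⟨b, hb⟩ := shifted_real_of_splits (a₄ := a₄) hx (depressedQuartic_splits_of_quintic h)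
    exact ⟨b, hb, (key b hb).1 h⟩
  · rintro ⟨b, hb, h⟩
    exact (key b hb).2 h

/-! ### Signs of the coefficients and of the roots -/

theorem exists_five_roots {a₀ a₁ a₂ a₃ a₄ : ℝ} (h : (quintic a₀ a₁ a₂ a₃ a₄).Splits) :
    ∃ a b c d e : ℝ, (∀ t ∈ [a, b, c, d, e], (quintic a₀ a₁ a₂ a₃ a₄).eval t = 0) ∧
      a₄ = -(a + b + c + d + e) ∧
      a₃ = a * b + a * c + a * d + a * e + b * c + b * d + b * e + c * d + c * e + d * e ∧
      a₂ = -(a * b * c + a * b * d + a * b * e + a * c * d + a * c * e + a * d * e + b * c * d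
        + b * c * e + b * d * e + c * d * e) ∧
      a₁ = a * b * c * d + a * b * c * e + a * b * d * e + a * c * d * e + b * c * d * e ∧
      a₀ = -(a * b * c * d * e) := by
  have hcard := h.natDegree_eq_card_roots
  have heval := h.eval_eq_prod_roots_of_monic (quintic_monic a₀ a₁ a₂ a₃ a₄)
  have hmem : ∀ t ∈ (quintic a₀ a₁ a₂ a₃ a₄).roots, (quintic a₀ a₁ a₂ a₃ a₄).eval t = 0 :=
    fun t ht => (mem_roots'.1 ht).2
  rw [quintic_natDegree] at hcard
  obtain ⟨l, hl⟩ := Quot.exists_rep (quintic a₀ a₁ a₂ a₃ a₄).roots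
  rw [← hl] at hcard heval hmem
  obtain ⟨a, b, c, d, e, rfl⟩ : ∃ a b c d e, l = [a, b, c, d, e] := by
    have : l.length = 5 := hcard.symm
    match l, this with
    | [a, b, c, d, e], _ => exact ⟨a, b, c, d, e, rfl⟩
  have hf : ∀ x, x ^ 5 + a₄ * x ^ 4 + a₃ * x ^ 3 + a₂ * x ^ 2 + a₁ * x + a₀
      = (x - a) * ((x - b) * ((x - c) * ((x - d) * (x - e)))) := fun x => by
    rw [← eval_quintic, heval]
    simp
  refine ⟨a, b, c, d, e, fun t ht => hmem t ht, ?_⟩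
  -- Five evaluation points give five linear equations that determine the five coefficients.
  have h0 := hf 0
  have h1 := hf 1
  have h2 := hf (-1)
  have h3 := hf 2
  have h4 := hf (-2)
  refine ⟨?_, ?_, ?_, ?_, ?_⟩ <;> linarith

theorem AllRootsNonneg.allRootsReal {f : ℝ[X]} (h : AllRootsNonneg f) : AllRootsReal f :=
  fun z hz => (h z hz).imp fun _ hr => hr.2

theorem AllRootsPos.allRootsNonneg {f : ℝ[X]} (h : AllRootsPos f) : AllRootsNonneg f :=
  fun z hz => (h z hz).imp fun _ hr => ⟨hr.1.le, hr.2⟩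

theorem AllRootsNonneg.nonneg_of_eval_eq_zero {f : ℝ[X]} (h : AllRootsNonneg f) {t : ℝ}
    (ht : f.eval t = 0) : 0 ≤ t := by
  obtain ⟨r, hr, h'⟩ := h t (by
    rw [← Complex.coe_algebraMap, aeval_algebraMap_apply, coe_aeval_eq_eval, ht, map_zero])
  rwa [Complex.ofReal_injective h']

theorem AllRootsPos.pos_of_eval_eq_zero {f : ℝ[X]} (h : AllRootsPos f) {t : ℝ}
    (ht : f.eval t = 0) : 0 < t := by
  obtain ⟨r, hr, h'⟩ := h t (by
    rw [← Complex.coe_algebraMap, aeval_algebraMap_apply, coe_aeval_eq_eval, ht, map_zero])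
  rwa [Complex.ofReal_injective h']

theorem quintic_splits_of_allRootsReal {a₀ a₁ a₂ a₃ a₄ : ℝ}
    (h : AllRootsReal (quintic a₀ a₁ a₂ a₃ a₄)) : (quintic a₀ a₁ a₂ a₃ a₄).Splits :=
  (splits_iff_forall_complex_root (quintic_monic _ _ _ _ _).ne_zero).2 h

theorem AllRootsNonneg.coeff_signs {a₀ a₁ a₂ a₃ a₄ : ℝ}
    (h : AllRootsNonneg (quintic a₀ a₁ a₂ a₃ a₄)) :
    a₄ ≤ 0 ∧ 0 ≤ a₃ ∧ a₂ ≤ 0 ∧ 0 ≤ a₁ ∧ a₀ ≤ 0 := by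
  obtain ⟨a, b, c, d, e, hr, h4, h3, h2, h1, h0⟩ :=
    exists_five_roots (quintic_splits_of_allRootsReal h.allRootsReal)
  have hr' : ∀ t ∈ [a, b, c, d, e], 0 ≤ t := fun t ht => h.nonneg_of_eval_eq_zero (hr t ht)
  simp only [List.mem_cons, List.not_mem_nil, or_false, forall_eq_or_imp, forall_eq] at hr'
  obtain ⟨ha, hb, hc, hd, he⟩ := hr'
  rw [h4, h3, h2, h1, h0]
  simp only [neg_nonpos]
  refine ⟨?_, ?_, ?_, ?_, ?_⟩ <;> positivity

theorem AllRootsPos.coeff_signs {a₀ a₁ a₂ a₃ a₄ : ℝ}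
    (h : AllRootsPos (quintic a₀ a₁ a₂ a₃ a₄)) :
    a₄ < 0 ∧ 0 < a₃ ∧ a₂ < 0 ∧ 0 < a₁ ∧ a₀ < 0 := by
  obtain ⟨a, b, c, d, e, hr, h4, h3, h2, h1, h0⟩ :=
    exists_five_roots (quintic_splits_of_allRootsReal h.allRootsNonneg.allRootsReal)
  have hr' : ∀ t ∈ [a, b, c, d, e], 0 < t := fun t ht => h.pos_of_eval_eq_zero (hr t ht)
  simp only [List.mem_cons, List.not_mem_nil, or_false, forall_eq_or_imp, forall_eq] at hr'
  obtain ⟨ha, hb, hc, hd, he⟩ := hr'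
  rw [h4, h3, h2, h1, h0]
  simp only [neg_neg_iff_pos]
  refine ⟨?_, ?_, ?_, ?_, ?_⟩ <;> positivity

theorem allRootsNonneg_of_coeff_signs {a₀ a₁ a₂ a₃ a₄ : ℝ}
    (h : (quintic a₀ a₁ a₂ a₃ a₄).Splits) (h4 : a₄ ≤ 0) (h3 : 0 ≤ a₃) (h2 : a₂ ≤ 0)
    (h1 : 0 ≤ a₁) (h0 : a₀ ≤ 0) : AllRootsNonneg (quintic a₀ a₁ a₂ a₃ a₄) := by
  intro z hz
  obtain ⟨r, rfl⟩ :=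
    (splits_iff_forall_complex_root (quintic_monic _ _ _ _ _).ne_zero).1 h z hz
  refine ⟨r, ?_, rfl⟩
  rw [← Complex.coe_algebraMap, aeval_algebraMap_apply, coe_aeval_eq_eval] at hz
  have hr : (quintic a₀ a₁ a₂ a₃ a₄).eval r = 0 := Complex.ofReal_injective hz
  rw [eval_quintic] at hr
  by_contra! hneg
  have k5 : r ^ 5 < 0 := Odd.pow_neg (by decide) hneg
  have k4 : a₄ * r ^ 4 ≤ 0 := mul_nonpos_of_nonpos_of_nonneg h4 (by positivity)
  have k3 : a₃ * r ^ 3 ≤ 0 :=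
    mul_nonpos_of_nonneg_of_nonpos h3 (Odd.pow_neg (by decide) hneg).le
  have k2 : a₂ * r ^ 2 ≤ 0 := mul_nonpos_of_nonpos_of_nonneg h2 (by positivity)
  have k1 : a₁ * r ≤ 0 := mul_nonpos_of_nonneg_of_nonpos h1 hneg.le
  linarith

theorem allRootsPos_of_constant_neg {a₀ a₁ a₂ a₃ a₄ : ℝ}
    (h : AllRootsNonneg (quintic a₀ a₁ a₂ a₃ a₄)) (h0 : a₀ < 0) :
    AllRootsPos (quintic a₀ a₁ a₂ a₃ a₄) := by
  intro z hz
  obtain ⟨r, hr, rfl⟩ := h z hz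
  refine ⟨r, lt_of_le_of_ne hr ?_, rfl⟩
  rintro rfl
  simp [quintic] at hz
  exact h0.ne hz

theorem allRootsNonneg_iff {a₀ a₁ a₂ a₃ a₄ : ℝ} {S : Fin 3 → ℂ} {x : ℤˣ → ℤˣ → ℂ}
    (hS : IsCardanoFamily (u₂ a₃ a₄) (u₃ a₂ a₃ a₄) S)
    (hx : IsFerrariFamily (u₂ a₃ a₄) (u₃ a₂ a₃ a₄) (u₄ a₁ a₂ a₃ a₄) x) :
    AllRootsNonneg (quintic a₀ a₁ a₂ a₃ a₄) ↔ CondsOneToNine a₀ a₁ a₂ a₃ a₄ S x := by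
  constructor
  · intro h
    have hf := quintic_splits_of_allRootsReal h.allRootsReal
    have hQ := depressedQuartic_splits_of_quintic hf
    have hΔ := discriminant_nonpos_of_splits (depressedCubic_splits_of_quartic hQ)
    obtain ⟨h4, h3, h2, h1, h0⟩ := h.coeff_signs
    obtain ⟨hb, hc⟩ := (coefficient_bounds_iff a₂ a₃ a₄).2 hΔ
    exact ⟨⟨h4, h3, hb, hc, h2⟩, (depressedQuartic_splits_iff_condSix hS hΔ).1 hQ, h1, h0,
      (quintic_splits_iff_condNine hx).1 hf⟩
  · rintro ⟨⟨h4, h3, -, -, h2⟩, -, h1, h0, h9⟩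
    exact allRootsNonneg_of_coeff_signs ((quintic_splits_iff_condNine hx).2 h9) h4 h3 h2 h1 h0

end MonicQuintic

/-! ### The main theorem -/

theorem corollary3p6 (a₀ a₁ a₂ a₃ a₄ : ℝ) (S : Fin 3 → ℂ) (x : ℤˣ → ℤˣ → ℂ)
    (hS : MonicQuintic.IsCardanoFamily (MonicQuintic.u₂ a₃ a₄) (MonicQuintic.u₃ a₂ a₃ a₄) S)
    (hx : MonicQuintic.IsFerrariFamily (MonicQuintic.u₂ a₃ a₄) (MonicQuintic.u₃ a₂ a₃ a₄)
      (MonicQuintic.u₄ a₁ a₂ a₃ a₄) x) :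
    (MonicQuintic.AllRootsReal (MonicQuintic.quintic a₀ a₁ a₂ a₃ a₄) ∨
        MonicQuintic.CondsOneToFive a₂ a₃ a₄ →
      ∃ θ : Fin 3 → ℝ, MonicQuintic.IsSortedReal S θ) ∧
    (MonicQuintic.AllRootsReal (MonicQuintic.quintic a₀ a₁ a₂ a₃ a₄) ∨
        (MonicQuintic.CondsOneToFive a₂ a₃ a₄ ∧ MonicQuintic.CondSix a₁ a₂ a₃ a₄ S ∧ 0 ≤ a₁) →
      ∃ b : Fin 4 → ℝ, MonicQuintic.IsSortedReal (MonicQuintic.shifted a₄ x) b) ∧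
    (MonicQuintic.AllRootsNonneg (MonicQuintic.quintic a₀ a₁ a₂ a₃ a₄) ↔
      MonicQuintic.CondsOneToNine a₀ a₁ a₂ a₃ a₄ S x) ∧
    (MonicQuintic.AllRootsPos (MonicQuintic.quintic a₀ a₁ a₂ a₃ a₄) ↔
      MonicQuintic.CondsOneToNine a₀ a₁ a₂ a₃ a₄ S x ∧
        a₄ < 0 ∧ 0 < a₃ ∧ a₂ < 0 ∧ 0 < a₁ ∧ a₀ < 0) := by
  have hreal : MonicQuintic.AllRootsReal (MonicQuintic.quintic a₀ a₁ a₂ a₃ a₄) →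
      (MonicQuintic.depressedQuartic (MonicQuintic.u₂ a₃ a₄) (MonicQuintic.u₃ a₂ a₃ a₄)
        (MonicQuintic.u₄ a₁ a₂ a₃ a₄)).Splits := fun h =>
    MonicQuintic.depressedQuartic_splits_of_quintic (MonicQuintic.quintic_splits_of_allRootsReal h)
  have hdisc : MonicQuintic.CondsOneToFive a₂ a₃ a₄ →
      MonicQuintic.u₃ a₂ a₃ a₄ ^ 2 + 4 / 27 * MonicQuintic.u₂ a₃ a₄ ^ 3 ≤ 0 := fun h =>
    (MonicQuintic.coefficient_bounds_iff a₂ a₃ a₄).1 ⟨h.2.2.1, h.2.2.2.1⟩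
  have hiff := MonicQuintic.allRootsNonneg_iff (a₀ := a₀) hS hx
  refine ⟨?_, ?_, hiff, ?_⟩
  · rintro (h | h)
    · exact hS.exists_isSortedReal (MonicQuintic.discriminant_nonpos_of_splits
        (MonicQuintic.depressedCubic_splits_of_quartic (hreal h)))
    · exact hS.exists_isSortedReal (hdisc h)
  · rintro (h | ⟨h, h6, -⟩)
    · exact MonicQuintic.shifted_real_of_splits hx (hreal h)
    · exact MonicQuintic.shifted_real_of_splits hx
        ((MonicQuintic.depressedQuartic_splits_iff_condSix hS (hdisc h)).2 h6)
  · constructor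
    · intro h
      exact ⟨hiff.1 h.allRootsNonneg, h.coeff_signs⟩
    · rintro ⟨h, -, -, -, -, h0⟩
      exact MonicQuintic.allRootsPos_of_constant_neg (hiff.2 h) h0
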